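/- For $n\ge 1$ let $Q_n=\{0,1\}^n$ with the Hamming distance $d$, and for $Y\subseteq Q_n$ put $d(x,Y)=\min_{y\in Y}d(x,y)$, with $d(x,\emptyset)=\infty$. The covering radius of $\mathcal C\subseteq Q_n$ is the smallest integer $R\ge 0$ such that every $x\in Q_n$ is within distance $R$ of some element of $\mathcal C$. For a coordinate $i\in\{1,\dots,n\}$ and $b\in\{0,1\}$ let $\mathcal C^{(i)}_b=\{c\in\mathcal C: c_i=b\}$, let $$N^{(i)}(\mathcal C)=\max_{x\in Q_n}\bigl(d(x,\mathcal C^{(i)}_0)+d(x,\mathcal C^{(i)}_1)\bigr),$$ and let $N_{\min}(\mathcal C)=\min_i N^{(i)}(\mathcal C)$. A normal $(n,R)$-code is a set $\mathcal C\subseteq Q_n$ with covering radius exactly $R$ such that $N_{\min}(\mathcal C)\le 2R+1$ and $N_{\min}(\mathcal C)\in\{2R,2R+1\}$. Let $K_\nu(n,R)$ be the smallest size of a normal $(n,R)$-code ($\infty$ if there is none), let $$\nu(n,R)=\frac{K_\nu(n,R)}{2^n/\sum_{i=0}^R\binom ni},$$ and let $\nu^*(R)=\limsup_{n\to\infty}\nu(n,R)$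 be the asymptotic worst-case density of normal binary covering codes of radius $R$. Theorem. For every integer $R\ge 2$, $$\nu^*(R)\ \le\ e\,(R\log R+\log R+\log\log R+4),$$ where $\log$ is the natural logarithm. -/

import Mathlib

open scoped ENNReal

/-- The hypercube `Q_n` of binary strings of length `n`. -/
abbrev Cube (n : ℕ) : Type := Fin n → ZMod 2

/-- `d(x, Y)`, the least Hamming distance from `x` to an element of `Y`; it is `⊤` (that is, `∞`)
when `Y` is empty. -/
noncomputable def distToSet {n : ℕ} (x : Cube n) (Y : Finset (Cube n)) : ℕ∞ :=
  ⨅ y ∈ Y, (hammingDist x y : ℕ∞)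

/-- The covering radius of `C` is `R`: `R` is the smallest natural number such that the Hamming
balls of radius `R` around the codewords cover the hypercube. Thus `C` is an `(n, R)`-code. -/
def HasCoveringRadius {n : ℕ} (C : Finset (Cube n)) (R : ℕ) : Prop :=
  IsLeast {r : ℕ | ∀ x : Cube n, ∃ c ∈ C, hammingDist x c ≤ r} R

/-- The codewords of `C` whose `i`-th coordinate is `b`. -/
def codeSlice {n : ℕ} (C : Finset (Cube n)) (i : Fin n) (b : ZMod 2) : Finset (Cube n) :=
  C.filter (fun x => x i = b)

/-- The norm of `C` with respect to the coordinate `i`. -/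
noncomputable def normAt {n : ℕ} (C : Finset (Cube n)) (i : Fin n) : ℕ∞ :=
  ⨆ x : Cube n, (distToSet x (codeSlice C i 0) + distToSet x (codeSlice C i 1))

/-- The minimum norm of `C` over all coordinates. -/
noncomputable def minNorm {n : ℕ} (C : Finset (Cube n)) : ℕ∞ :=
  ⨅ i : Fin n, normAt C i

/-- `C` has norm `N`. -/
def HasNorm {n : ℕ} (C : Finset (Cube n)) (N : ℕ) : Prop :=
  minNorm C ≤ (N : ℕ∞)

/-- `C` is a normal `(n, R)`-code: its covering radius is `R`, it has norm `2R + 1`, and its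
minimum norm is `2R + 1` or `2R`. -/
def IsNormalCode {n : ℕ} (C : Finset (Cube n)) (R : ℕ) : Prop :=
  HasCoveringRadius C R ∧ HasNorm C (2 * R + 1) ∧
    (minNorm C = ((2 * R + 1 : ℕ) : ℕ∞) ∨ minNorm C = ((2 * R : ℕ) : ℕ∞))

/-- The size of the smallest normal `(n, R)`-code (`⊤` if there is none, which happens only
when `n ≤ R`). -/
noncomputable def minNormalCodeSize (n R : ℕ) : ℕ∞ :=
  ⨅ (C : Finset (Cube n)) (_ : IsNormalCode C R), (C.card : ℕ∞)

/-- The sum of the binomial coefficients `n.choose i` over `0 ≤ i ≤ R`, which is the size of a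
Hamming ball of radius `R` in `Q_n`. -/
def binomLE (n R : ℕ) : ℕ :=
  ∑ i ∈ Finset.range (R + 1), n.choose i

/-- The optimal density `ν(n, R)` of a normal `(n, R)`-code. -/
noncomputable def normalDensity (n R : ℕ) : ℝ≥0∞ :=
  (minNormalCodeSize n R : ℝ≥0∞) / ((2 : ℝ≥0∞) ^ n / (binomLE n R : ℝ≥0∞))

/-- The asymptotic worst-case density `ν*(R)` of normal codes of radius `R`. -/
noncomputable def normalDensityStar (R : ℕ) : ℝ≥0∞ :=
  Filter.limsup (fun n : ℕ => normalDensity n R) Filter.atTop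

/-!
# The density of normal covering codes

If `C` covers `Q_n` with radius `R`, then `{0, 1} × C` covers `Q_{n + 1}` with radius `R`, and its
two halves along the new coordinate are at distances adding up to at most `2 * R + 1` from any
point. For large `n` a code whose density stays bounded is too small to have covering radius less
than `R`, so `{0, 1} × C` is then normal. Hence normality costs nothing asymptotically, and it
suffices to bound the density `μ n` of ordinary covering codes of radius `R`.

Write `n = x + y` with `x = n / R` rounded down. Let `H` be a code of radius one in `Q_x`, of
density close to one, and let `B` be a greedily chosen subset of `Q_y` whose balls of radius
`R - 1` miss only a set `T` of proportion at most `exp (-s)`. Then `H × B` covers everything except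
`Q_x × T`, which is covered by `A × T` for an optimal code `A` of radius `R` in `Q_x`. The two
parts contribute about `(1 + 1 / (R - 1)) ^ (R - 1) * s` and `exp (-s) * R ^ R * μ (n / R)` to the
density (`coverDensity_add_le`). With `s = R log R + log R + log log R + 2` the second coefficient
is `exp (-2) / (R log R)`; since `(1 + 1 / (R - 1)) ^ (R - 1) < e`, the recursion contracts to a
limit smaller than `e * (s + 2)` (`exists_eventually_coverDensity_le`).

The codes `H` have to exist for every large length (`eventually_hasDomatic`). They are colour
classes of colourings of the cube for which every unit ball sees all colours. The syndromes of
Hamming codes give such colourings with `2 ^ m` colours in length `2 ^ m - 1`. Covering the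
vector space `F_q ^ r` by its lines turns a colouring with `s * q` colours into one with
`s * q ^ r` colours without changing the ratio of length to colours much. Taking `q` to be a power
of three just below a power of two, the products `2 ^ a * q ^ r` come within a factor
`1 + o(1)` of every large number.
-/

open Filter Topology

/-! ### Colourings of the cube in which every unit ball sees every colour -/

/-- A colouring of a binary cube is domatic if every closed Hamming ball of radius one contains
every colour; equivalently, every colour class is a covering code of radius one. -/
def IsDomatic {ι G : Type*} [Fintype ι] (f : (ι → ZMod 2) → G) : Prop :=
  ∀ u g, ∃ u', hammingDist u u' ≤ 1 ∧ f u' = g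

/-- `Q_n` has a domatic colouring with `k` colours. -/
def HasDomatic (n k : ℕ) : Prop :=
  ∃ f : Cube n → Fin k, IsDomatic f

/-- Spare coordinates and spare colours may be discarded. -/
theorem IsDomatic.hasDomatic {ι G : Type*} [Fintype ι] [Fintype G] {f : (ι → ZMod 2) → G}
    (hf : IsDomatic f) {n k : ℕ} (hn : Fintype.card ι ≤ n) (hk : k ≤ Fintype.card G)
    (hk0 : k ≠ 0) : HasDomatic n k := by
  classical
  obtain ⟨e⟩ : Nonempty (ι ↪ Fin n) :=
    Function.Embedding.nonempty_of_card_le (by simpa using hn)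
  obtain ⟨i⟩ : Nonempty (Fin k ↪ G) :=
    Function.Embedding.nonempty_of_card_le (by simpa using hk)
  have : Nonempty (Fin k) := ⟨⟨0, Nat.pos_of_ne_zero hk0⟩⟩
  refine ⟨fun u => Function.invFun i (f (u ∘ e)), fun u g => ?_⟩
  obtain ⟨w, hw, hwg⟩ := hf (u ∘ e) (i g)
  refine ⟨Function.extend e w u, le_trans ?_ hw, ?_⟩
  · unfold hammingDist
    rw [← Finset.card_map e]
    refine Finset.card_le_card fun j hj => ?_
    simp only [Finset.mem_filter, Finset.mem_univ, true_and, Finset.mem_map] at hj ⊢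
    by_cases h : ∃ a, e a = j
    · obtain ⟨a, rfl⟩ := h
      exact ⟨a, by rwa [e.injective.extend_apply] at hj, rfl⟩
    · exact absurd (Function.extend_apply' w u j h).symm hj
  · have : Function.extend e w u ∘ e = w := funext fun a => e.injective.extend_apply w u a
    simp only [this, hwg]
    exact Function.leftInverse_invFun i.injective g

theorem HasDomatic.mono {n n' k k' : ℕ} (h : HasDomatic n k) (hn : n ≤ n') (hk : k' ≤ k)
    (hk0 : k' ≠ 0) : HasDomatic n' k' := by
  obtain ⟨f, hf⟩ := h
  exact hf.hasDomatic (by simpa using hn) (by simpa using hk) hk0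

/-- The syndrome map of the Hamming code is a domatic colouring. -/
theorem hasDomatic_hamming (m : ℕ) : HasDomatic (2 ^ m - 1) (2 ^ m) := by
  classical
  let E := Fin m → ZMod 2
  have hE : Fintype.card E = 2 ^ m := by simp [E, ZMod.card]
  let f : ({e : E // e ≠ 0} → ZMod 2) → E := fun u => ∑ e, u e • e.1
  have hf : IsDomatic f := by
    intro u g
    by_cases h : g - f u = 0
    · exact ⟨u, by simp, (sub_eq_zero.mp h).symm⟩
    · refine ⟨u + Pi.single ⟨g - f u, h⟩ 1, ?_, ?_⟩
      · unfold hammingDist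
        refine le_trans (Finset.card_le_card (t := {⟨g - f u, h⟩}) fun j hj => ?_) (by simp)
        by_contra hne
        simp only [Finset.mem_singleton] at hne
        simp [Pi.single_eq_of_ne hne] at hj
      · have : f (u + Pi.single ⟨g - f u, h⟩ 1) = f u + (g - f u) := by
          simp only [f, Pi.add_apply, add_smul, Finset.sum_add_distrib]
          congr 1
          rw [Finset.sum_eq_single ⟨g - f u, h⟩]
          · simp [f]
          · intro b _ hb
            rw [Pi.single_eq_of_ne hb, zero_smul]
          · simp
        rw [this]; abel
  exact hf.hasDomatic (by rw [Fintype.card_subtype_compl, hE]; simp) hE.ge (by positivity)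

/-- Changing a single block of `u` costs at most the distance within this block. -/
theorem hammingDist_update_block {P J : Type*} [Fintype P] [Fintype J] [DecidableEq P]
    (u : P × J → ZMod 2) (l : P) (w : J → ZMod 2) :
    hammingDist u (fun p => if p.1 = l then w p.2 else u p) ≤
      hammingDist (fun j => u (l, j)) w := by
  unfold hammingDist
  rw [← Finset.card_map (s := Finset.univ.filter fun j => u (l, j) ≠ w j)
    ⟨fun j => (l, j), fun a b h => (Prod.mk.inj h).2⟩]
  refine Finset.card_le_card fun p hp => ?_
  obtain ⟨a, j⟩ := p
  simp only [Finset.mem_filter, Finset.mem_univ, true_and, Finset.mem_map] at hp ⊢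
  by_cases h : a = l
  · subst h
    exact ⟨j, by simpa using hp, rfl⟩
  · simp [h] at hp

/-- The lines of `F ^ r` cover `F ^ r` with no overlap outside the origin. Assigning to each line
`l` a block of `m` coordinates, coloured by the group `ZMod s × l`, and adding up the colours of
the blocks gives a domatic colouring by `ZMod s × F ^ r`. -/
theorem HasDomatic.lines {m s : ℕ} (F : Type*) [Field F] [Fintype F] (hs : s ≠ 0)
    (h : HasDomatic m (s * Fintype.card F)) {r : ℕ} (hr : r ≠ 0) :
    HasDomatic (Nat.card (Projectivization F (Fin r → F)) * m) (s * Fintype.card F ^ r) := by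
  classical
  have : NeZero s := ⟨hs⟩
  have : Nonempty (Fin r) := ⟨⟨0, Nat.pos_of_ne_zero hr⟩⟩
  obtain ⟨f₀, hf₀⟩ := h
  let e : Fin (s * Fintype.card F) ≃ ZMod s × F := Fintype.equivOfCardEq (by simp [ZMod.card])
  let P := Projectivization F (Fin r → F)
  have : Fintype P := Fintype.ofFinite P
  let c : (P × Fin m → ZMod 2) → P → ZMod s × F := fun u l => e (f₀ fun j => u (l, j))
  let f : (P × Fin m → ZMod 2) → ZMod s × (Fin r → F) :=
    fun u => ∑ l, ((c u l).1, (c u l).2 • l.rep)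
  have hf : IsDomatic f := by
    intro u g
    obtain ⟨l, t, ht⟩ : ∃ (l : P) (t : F), (g - f u).2 = t • l.rep := by
      by_cases h0 : (g - f u).2 = 0
      · exact ⟨Projectivization.mk F (fun _ => 1) (by simp [funext_iff]), 0, by simp [h0]⟩
      · obtain ⟨a, ha⟩ := Projectivization.exists_smul_eq_mk_rep F _ h0
        refine ⟨Projectivization.mk F _ h0, ((a⁻¹ : Fˣ) : F), ?_⟩
        rw [← ha]
        simp [Units.smul_def, smul_smul]
    obtain ⟨w, hw, hwe⟩ := hf₀ (fun j => u (l, j)) (e.symm (c u l + ((g - f u).1, t)))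
    refine ⟨fun p => if p.1 = l then w p.2 else u p,
      (hammingDist_update_block u l w).trans hw, ?_⟩
    set u' : P × Fin m → ZMod 2 := fun p => if p.1 = l then w p.2 else u p with hu'
    have hcl : c u' l = c u l + ((g - f u).1, t) := by
      simp [c, hu', hwe]
    have hcne : ∀ l' ≠ l, c u' l' = c u l' := by
      intro l' hl'
      simp [c, hu', hl']
    have hdiff : f u' - f u = g - f u := by
      simp only [f]
      rw [← Finset.sum_sub_distrib, Finset.sum_eq_single l]
      · rw [hcl]
        refine Prod.ext ?_ ?_
        · simp [f]
        · change _ = (g - f u).2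
          rw [ht]
          simp [add_smul]
      · intro l' _ hl'
        rw [hcne l' hl', sub_self]
      · simp
    exact sub_left_inj.mp hdiff
  refine hf.hasDomatic ?_ ?_ ?_
  · simp [Nat.card_eq_fintype_card, P]
  · simp [ZMod.card]
  · exact mul_ne_zero hs (pow_ne_zero _ Fintype.card_ne_zero)

/-! ### Covering codes -/

/-- The Hamming balls of radius `R` around the codewords of `C` cover the cube. -/
def Covers {n : ℕ} (C : Finset (Cube n)) (R : ℕ) : Prop :=
  ∀ x : Cube n, ∃ c ∈ C, hammingDist x c ≤ R

/-- The smallest size of a code of length `n` and covering radius at most `R`. -/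
noncomputable def coverNum (n R : ℕ) : ℕ :=
  sInf {k | ∃ C : Finset (Cube n), Covers C R ∧ C.card = k}

theorem exists_covers_card_eq (n R : ℕ) :
    ∃ C : Finset (Cube n), Covers C R ∧ C.card = coverNum n R :=
  Nat.sInf_mem (s := {k | ∃ C : Finset (Cube n), Covers C R ∧ C.card = k})
    ⟨_, Finset.univ, fun x => ⟨x, by simp, by simp⟩, rfl⟩

theorem Covers.coverNum_le {n R : ℕ} {C : Finset (Cube n)} (h : Covers C R) :
    coverNum n R ≤ C.card :=
  Nat.sInf_le ⟨C, h, rfl⟩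

/-- The smallest colour class of a domatic colouring is a good covering code of radius one. -/
theorem HasDomatic.coverNum_mul_le {n k : ℕ} (h : HasDomatic n k) :
    coverNum n 1 * k ≤ 2 ^ n := by
  obtain ⟨f, hf⟩ := h
  have hcov : ∀ g, Covers (Finset.univ.filter fun x => f x = g) 1 := by
    intro g x
    obtain ⟨c, hc, hcg⟩ := hf x g
    exact ⟨c, by simpa using hcg, hc⟩
  calc coverNum n 1 * k = ∑ _g : Fin k, coverNum n 1 := by simp [mul_comm]
    _ ≤ ∑ g : Fin k, (Finset.univ.filter fun x => f x = g).card :=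
        Finset.sum_le_sum fun g _ => (hcov g).coverNum_le
    _ = (Finset.univ : Finset (Cube n)).card :=
        (Finset.card_eq_sum_card_fiberwise (by simp)).symm
    _ = 2 ^ n := by simp [ZMod.card]

/-- The size of a Hamming ball. -/
theorem card_ball (n R : ℕ) (x : Cube n) :
    (Finset.univ.filter fun y => hammingDist x y ≤ R).card = binomLE n R := by
  classical
  have h2 : ∀ a : ZMod 2, a ≠ 0 → a = 1 := by decide
  have hR : ((Finset.univ : Finset (Finset (Fin n))).filter fun s => s.card ≤ R).card
      = binomLE n R := by
    have : ((Finset.univ : Finset (Finset (Fin n))).filter fun s => s.card ≤ R)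
        = (Finset.range (R + 1)).biUnion fun i => Finset.powersetCard i Finset.univ := by
      ext s
      simp [Finset.mem_powersetCard]
    rw [this, Finset.card_biUnion]
    · simp [binomLE]
    · intro i _ j _ hij
      exact Finset.pairwise_disjoint_powersetCard _ hij
  rw [← hR]
  refine Finset.card_bij' (fun y _ => Finset.univ.filter fun i => x i ≠ y i)
    (fun s _ => fun i => if i ∈ s then x i + 1 else x i) ?_ ?_ ?_ ?_
  · intro y hy
    simpa [hammingDist] using hy
  · intro s hs
    simpa [hammingDist] using hs
  · intro y _
    funext i
    by_cases h : x i = y i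
    · simp [h]
    · have := h2 (y i - x i) (sub_ne_zero.mpr (Ne.symm h))
      simp [h, ← this]
  · intro s _
    ext i
    simp

theorem binomLE_le_two_pow (n R : ℕ) : (binomLE n R : ℝ) ≤ 2 ^ n := by
  have h : binomLE n R ≤ (Finset.univ : Finset (Cube n)).card := by
    rw [← card_ball n R 0]
    exact Finset.card_filter_le _ _
  have h2 : (Finset.univ : Finset (Cube n)).card = 2 ^ n := by simp [ZMod.card]
  rw [h2] at h
  exact_mod_cast h

theorem binomLE_pos (n R : ℕ) : 0 < binomLE n R := by
  unfold binomLE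
  rw [Finset.sum_range_succ']
  simp

/-- The sphere covering bound. -/
theorem Covers.two_pow_le {n R : ℕ} {C : Finset (Cube n)} (h : Covers C R) :
    2 ^ n ≤ C.card * binomLE n R := by
  classical
  calc 2 ^ n = (Finset.univ : Finset (Cube n)).card := by simp [ZMod.card]
    _ ≤ (C.biUnion fun c => Finset.univ.filter fun y => hammingDist c y ≤ R).card := by
        refine Finset.card_le_card fun x _ => ?_
        obtain ⟨c, hc, hx⟩ := h x
        simp only [Finset.mem_biUnion, Finset.mem_filter, Finset.mem_univ, true_and]
        exact ⟨c, hc, by rwa [hammingDist_comm]⟩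
    _ ≤ ∑ c ∈ C, (Finset.univ.filter fun y => hammingDist c y ≤ R).card :=
        Finset.card_biUnion_le
    _ = C.card * binomLE n R := by simp [card_ball]

/-- The points of the cube that are farther than `R` from `B`. -/
def uncovered {n : ℕ} (B : Finset (Cube n)) (R : ℕ) : Finset (Cube n) :=
  Finset.univ.filter fun x => ∀ b ∈ B, ¬ hammingDist x b ≤ R

/-- Some ball meets a given set in at least the average proportion. -/
theorem exists_ball_inter_card {n : ℕ} (R : ℕ) (U : Finset (Cube n)) :
    ∃ z : Cube n, U.card * binomLE n R ≤
      2 ^ n * (U.filter fun x => hammingDist x z ≤ R).card := by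
  by_contra! h
  have hsum : ∑ z : Cube n, (U.filter fun x => hammingDist x z ≤ R).card
      = U.card * binomLE n R := by
    simp_rw [Finset.card_filter]
    rw [Finset.sum_comm]
    simp_rw [← Finset.card_filter, card_ball]
    simp
  have hlt : ∑ z : Cube n, 2 ^ n * (U.filter fun x => hammingDist x z ≤ R).card
      < ∑ _z : Cube n, U.card * binomLE n R :=
    Finset.sum_lt_sum_of_nonempty Finset.univ_nonempty fun z _ => h z
  rw [← Finset.mul_sum, hsum] at hlt
  simp [ZMod.card] at hlt

/-- Greedily chosen balls leave a proportion of the cube uncovered that decays geometrically. -/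
theorem exists_uncovered_card_le (n R t : ℕ) :
    ∃ B : Finset (Cube n), B.card ≤ t ∧
      ((uncovered B R).card : ℝ) ≤ 2 ^ n * (1 - binomLE n R / 2 ^ n) ^ t := by
  classical
  have hq : (0 : ℝ) ≤ 1 - binomLE n R / 2 ^ n := by
    rw [sub_nonneg, div_le_one (by positivity)]
    exact binomLE_le_two_pow n R
  induction t with
  | zero =>
    refine ⟨∅, le_rfl, ?_⟩
    have : uncovered (∅ : Finset (Cube n)) R = Finset.univ := by simp [uncovered]
    rw [this]
    simp [ZMod.card]
  | succ t ih =>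
    obtain ⟨B, hB, hU⟩ := ih
    obtain ⟨z, hz⟩ := exists_ball_inter_card R (uncovered B R)
    refine ⟨insert z B, (Finset.card_insert_le _ _).trans (by omega), ?_⟩
    have hsplit : ((uncovered B R).filter fun x => hammingDist x z ≤ R).card
        + (uncovered (insert z B) R).card = (uncovered B R).card := by
      rw [← Finset.card_filter_add_card_filter_not (s := uncovered B R)
        (fun x => hammingDist x z ≤ R)]
      congr 2
      ext x
      simp [uncovered, and_comm]
    have hz' : ((uncovered B R).card : ℝ) * binomLE n R ≤
        2 ^ n * ((uncovered B R).filter fun x => hammingDist x z ≤ R).card := by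
      exact_mod_cast hz
    have hs' : (((uncovered B R).filter fun x => hammingDist x z ≤ R).card : ℝ)
        + (uncovered (insert z B) R).card = (uncovered B R).card := by
      exact_mod_cast hsplit
    have h3 : ((uncovered B R).card : ℝ) * (binomLE n R / 2 ^ n) ≤
        ((uncovered B R).filter fun x => hammingDist x z ≤ R).card := by
      rw [← mul_div_assoc, div_le_iff₀ (by positivity)]
      linarith
    calc ((uncovered (insert z B) R).card : ℝ)
        ≤ (uncovered B R).card * (1 - binomLE n R / 2 ^ n) := by linarith
      _ ≤ 2 ^ n * (1 - binomLE n R / 2 ^ n) ^ t * (1 - binomLE n R / 2 ^ n) := by gcongr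
      _ = 2 ^ n * (1 - binomLE n R / 2 ^ n) ^ (t + 1) := by ring

/-! ### Codes on a product of two cubes -/

theorem hammingDist_append {x y : ℕ} (u u' : Cube x) (v v' : Cube y) :
    hammingDist (Fin.append u v) (Fin.append u' v') = hammingDist u u' + hammingDist v v' := by
  simp only [hammingDist, Finset.card_filter, Fin.sum_univ_add, Fin.append_left,
    Fin.append_right]

/-- A code covering with radius one times an arbitrary set `B`, together with a covering code times
the set of points that `B` misses. -/
theorem coverNum_add_le {x y R : ℕ} (hR : R ≠ 0) (B : Finset (Cube y)) :
    coverNum (x + y) R ≤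
      coverNum x 1 * B.card + coverNum x R * (uncovered B (R - 1)).card := by
  classical
  obtain ⟨H, hH, hHc⟩ := exists_covers_card_eq x 1
  obtain ⟨A, hA, hAc⟩ := exists_covers_card_eq x R
  let ap : Cube x × Cube y → Cube (x + y) := fun p => Fin.append p.1 p.2
  have hcov : Covers ((H ×ˢ B).image ap ∪ (A ×ˢ uncovered B (R - 1)).image ap) R := by
    intro w
    obtain ⟨u, v, rfl⟩ : ∃ (u : Cube x) (v : Cube y), w = Fin.append u v :=
      ⟨_, _, (Fin.append_castAdd_natAdd (f := w)).symm⟩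
    by_cases hv : v ∈ uncovered B (R - 1)
    · obtain ⟨a, ha, hua⟩ := hA u
      refine ⟨Fin.append a v, ?_, by simpa [hammingDist_append] using hua⟩
      exact Finset.mem_union_right _ (Finset.mem_image.mpr ⟨(a, v), by simp [ha, hv], rfl⟩)
    · obtain ⟨b, hb, hvb⟩ : ∃ b ∈ B, hammingDist v b ≤ R - 1 := by
        simpa [uncovered] using hv
      obtain ⟨h, hh, huh⟩ := hH u
      refine ⟨Fin.append h b, ?_, by rw [hammingDist_append]; omega⟩
      exact Finset.mem_union_left _ (Finset.mem_image.mpr ⟨(h, b), by simp [hh, hb], rfl⟩)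
  refine hcov.coverNum_le.trans ((Finset.card_union_le _ _).trans ?_)
  rw [← hHc, ← hAc, ← Finset.card_product, ← Finset.card_product]
  exact Nat.add_le_add Finset.card_image_le Finset.card_image_le

/-! ### Asymptotically perfect codes of radius one -/

theorem mul_log_two_ne_mul_log_three {b : ℕ} (hb : b ≠ 0) (c : ℕ) :
    (c : ℝ) * Real.log 2 ≠ b * Real.log 3 := by
  intro h
  rw [← Real.log_pow, ← Real.log_pow] at h
  have h2 : (2 : ℝ) ^ c = 3 ^ b :=
    Real.log_injOn_pos (Set.mem_Ioi.mpr (by positivity)) (Set.mem_Ioi.mpr (by positivity)) h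
  have h3 : 2 ^ c = 3 ^ b := by exact_mod_cast h2
  have hodd : Odd (2 ^ c) := h3 ▸ Odd.pow (by decide)
  have hc : c = 0 := by
    by_contra hc
    exact (Nat.not_odd_iff_even.mpr ((Nat.even_pow.mpr ⟨even_two, hc⟩))) hodd
  subst hc
  exact absurd h3.symm (by simpa using hb)

/-- Some power of two exceeds some power of three by an arbitrarily small factor. -/
theorem exists_log_near {δ : ℝ} (hδ : 0 < δ) :
    ∃ b c : ℕ, b ≠ 0 ∧ 0 < (c : ℝ) * Real.log 2 - b * Real.log 3 ∧
      (c : ℝ) * Real.log 2 - b * Real.log 3 ≤ δ := by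
  have l2 : 0 < Real.log 2 := Real.log_pos (by norm_num)
  have l3 : 0 < Real.log 3 := Real.log_pos (by norm_num)
  obtain ⟨n, hn⟩ := exists_nat_gt (Real.log 2 / δ)
  have hn0 : 0 < n := by
    have : (0 : ℝ) < n := (div_pos l2 hδ).trans hn
    exact_mod_cast this
  obtain ⟨j, k, hk, -, hjk⟩ :=
    Real.exists_int_int_abs_mul_sub_le (Real.log 3 / Real.log 2) hn0
  have hk' : (0 : ℝ) < k := by exact_mod_cast hk
  have hj : 0 ≤ j := by
    by_contra! hj
    have hj' : (j : ℝ) ≤ -1 := by exact_mod_cast Int.le_sub_one_of_lt hj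
    have h1 : (1 : ℝ) / (n + 1) ≤ 1 := by
      rw [div_le_one (by positivity)]
      linarith [(Nat.cast_nonneg n : (0 : ℝ) ≤ n)]
    have h2 : 0 < (k : ℝ) * (Real.log 3 / Real.log 2) := by positivity
    linarith [(abs_le.mp hjk).2]
  lift j to ℕ using hj
  lift k to ℕ using hk.le
  have hk0 : k ≠ 0 := by
    rintro rfl
    simp at hk
  have habs : |(k : ℝ) * Real.log 3 - j * Real.log 2| ≤ δ := by
    have h1 : (k : ℝ) * Real.log 3 - j * Real.log 2
        = (k * (Real.log 3 / Real.log 2) - j) * Real.log 2 := by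
      field_simp
    rw [h1, abs_mul, abs_of_pos l2]
    simp only [Int.cast_natCast] at hjk
    calc _ ≤ 1 / ((n : ℝ) + 1) * Real.log 2 := by gcongr
      _ = Real.log 2 / (n + 1) := by ring
      _ ≤ δ := by
        rw [div_lt_iff₀ hδ] at hn
        rw [div_le_iff₀ (by positivity)]
        nlinarith
  rcases lt_or_gt_of_ne (mul_log_two_ne_mul_log_three hk0 j) with h | h
  · -- Here `2 ^ j < 3 ^ k`: take the last power of `2 ^ j / 3 ^ k` above `1 / 2`, and double it.
    set d := (k : ℝ) * Real.log 3 - j * Real.log 2 with hd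
    have hd0 : 0 < d := sub_pos.mpr h
    have hdδ : d ≤ δ := (le_abs_self _).trans habs
    have hex : ∃ m : ℕ, Real.log 2 ≤ (m + 1 : ℕ) * d := by
      obtain ⟨m, hm⟩ := exists_nat_gt (Real.log 2 / d)
      rw [div_lt_iff₀ hd0] at hm
      exact ⟨m, hm.le.trans (by push_cast; nlinarith)⟩
    classical
    set m := Nat.find hex with hm
    have hm1 : Real.log 2 ≤ (m + 1 : ℕ) * d := Nat.find_spec hex
    have hm2 : (m : ℝ) * d < Real.log 2 := by
      rcases Nat.eq_zero_or_pos m with h0 | h0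
      · rw [h0]; simpa using l2
      · have := Nat.find_min hex (m := m - 1) (by omega)
        rw [Nat.sub_add_cancel h0] at this
        exact not_le.mp this
    push_cast at hm1
    have key : ((j * m + 1 : ℕ) : ℝ) * Real.log 2 - ((k * m : ℕ) : ℝ) * Real.log 3
        = Real.log 2 - m * d := by
      rw [hd]; push_cast; ring
    rcases Nat.eq_zero_or_pos m with h0 | h0
    · -- If `m = 0` then `log 2 ≤ δ`, and the quotient `4 / 3` is close enough to `1`.
      refine ⟨1, 2, one_ne_zero, ?_, ?_⟩
      · have : Real.log 3 < Real.log (2 ^ 2) := Real.log_lt_log (by norm_num) (by norm_num)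
        rw [Real.log_pow] at this
        push_cast at this ⊢
        linarith
      · have : Real.log 2 < Real.log 3 := Real.log_lt_log (by norm_num) (by norm_num)
        rw [h0] at hm1
        push_cast at hm1 ⊢
        linarith
    · refine ⟨k * m, j * m + 1, by positivity, ?_, ?_⟩ <;> rw [key] <;> linarith
  · exact ⟨k, j, hk0, by linarith, by linarith [(abs_le.mp habs).1]⟩

/-- If `ρ = 2 ^ c / q > 1`, then every large number is within a factor `ρ` of a product
`2 ^ a * q ^ r` with `r ≠ 0`. -/
theorem exists_two_pow_mul_pow_near {q c : ℕ} (hq : 0 < q) (hqc : q < 2 ^ c) :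
    ∃ X₀ : ℝ, ∀ X ≥ X₀, ∃ a r : ℕ, r ≠ 0 ∧ (2 : ℝ) ^ a * q ^ r ≤ X ∧
      X < 2 ^ c / q * (2 ^ a * q ^ r) := by
  have hq' : (0 : ℝ) < q := by exact_mod_cast hq
  set ρ : ℝ := 2 ^ c / q with hρ
  have hρ1 : 1 < ρ := by
    rw [hρ, one_lt_div hq']
    exact_mod_cast hqc
  obtain ⟨N, hN⟩ := pow_unbounded_of_one_lt (2 * ρ) hρ1
  refine ⟨max 1 (2 ^ (c * N)), fun X hX => ?_⟩
  have hX1 : 1 ≤ X := (le_max_left _ _).trans hX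
  have hX2 : (2 : ℝ) ^ (c * N) ≤ X := (le_max_right _ _).trans hX
  obtain ⟨A, hA1, hA2⟩ := exists_nat_pow_near (x := X * ρ) (y := 2) (by nlinarith) (by norm_num)
  have hex : ∃ r : ℕ, (2 : ℝ) ^ (A + 1) ≤ X * ρ ^ r := by
    refine ⟨N, ?_⟩
    rw [pow_succ]
    nlinarith
  classical
  set r := Nat.find hex with hr
  have hr1 : (2 : ℝ) ^ (A + 1) ≤ X * ρ ^ r := Nat.find_spec hex
  have hrN : r ≤ N := by
    refine Nat.find_min' hex ?_
    rw [pow_succ]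
    nlinarith
  have hr0 : r ≠ 0 := by
    intro h0
    rw [h0, pow_zero] at hr1
    nlinarith
  have hr2 : X * ρ ^ (r - 1) < 2 ^ (A + 1) := not_le.mp (Nat.find_min hex (by omega))
  have hcr : c * r ≤ A + 1 := by
    have h1 : (2 : ℝ) ^ (c * N) < 2 ^ (A + 1) := by nlinarith
    have h2 : c * N < A + 1 := (pow_lt_pow_iff_right₀ (by norm_num)).mp h1
    exact (Nat.mul_le_mul_left c hrN).trans h2.le
  have hval : (2 : ℝ) ^ (A + 1 - c * r) * q ^ r * ρ ^ r = 2 ^ (A + 1) := by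
    rw [hρ, div_pow, ← pow_mul]
    field_simp
    rw [← pow_add, Nat.sub_add_cancel hcr]
  have hρr : 0 < ρ ^ (r - 1) := by positivity
  have hρs : ρ ^ r = ρ ^ (r - 1) * ρ := by
    rw [← pow_succ, Nat.sub_add_cancel (Nat.pos_of_ne_zero hr0)]
  refine ⟨A + 1 - c * r, r, hr0, ?_, ?_⟩
  · rw [← hval] at hr1
    exact le_of_mul_le_mul_right hr1 (by positivity)
  · rw [← hval, hρs] at hr2
    refine lt_of_mul_lt_mul_right (a := ρ ^ (r - 1)) ?_ hρr.le
    calc X * ρ ^ (r - 1) < _ := hr2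
      _ = _ := by ring

/-- Domatic colourings with asymptotically as many colours as there are points in a unit ball.
The number of colours is taken to be `2 ^ a * q ^ r` with `q` a power of three slightly less than
`2 ^ c`: a Hamming code of length `2 ^ (a + c) - 1` has at least `2 ^ a * q` colours, with little
loss, and the lines of `F_q ^ r` turn them into `2 ^ a * q ^ r` colours. -/
theorem eventually_hasDomatic {ε : ℝ} (hε : 0 < ε) :
    ∀ᶠ n : ℕ in Filter.atTop, ∃ k : ℕ, k ≠ 0 ∧ HasDomatic n k ∧ (n : ℝ) ≤ (1 + ε) * k := by
  -- The choice of `δ` gives `(1 + δ) * (1 + 4 * δ) ≤ 1 + ε`.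
  set δ : ℝ := min (1 / 2) (ε / 7) with hδ
  have hδ0 : 0 < δ := by positivity
  have hδ1 : δ ≤ 1 / 2 := min_le_left _ _
  have hδ2 : δ ≤ ε / 7 := min_le_right _ _
  obtain ⟨b, c, hb, hbc0, hbc⟩ := exists_log_near (Real.log_pos (by linarith : 1 < 1 + δ))
  set q : ℕ := 3 ^ b with hq
  have hq0 : 0 < q := by positivity
  have hqr : (0 : ℝ) < q := by exact_mod_cast hq0
  have hlogq : Real.log q = b * Real.log 3 := by rw [hq]; push_cast; exact Real.log_pow _ _
  have hqc' : (q : ℝ) < 2 ^ c := by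
    rw [← Real.log_lt_log_iff hqr (by positivity), hlogq, Real.log_pow]
    linarith
  have hqc : q < 2 ^ c := by exact_mod_cast hqc'
  have hρ : (2 : ℝ) ^ c ≤ (1 + δ) * q := by
    rw [← Real.log_le_log_iff (by positivity) (by positivity),
      Real.log_mul (by positivity) hqr.ne', hlogq, Real.log_pow]
    linarith
  -- A small quotient `2 ^ c / q > 1` of integers forces `q` to be large.
  have hqδ : 1 ≤ δ * q := by
    have : (q : ℝ) + 1 ≤ 2 ^ c := by exact_mod_cast hqc
    linarith
  have hq1 : (0 : ℝ) < q - 1 := by nlinarith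
  set σ : ℝ := 2 ^ c / (q - 1) with hσ
  have hσ0 : 0 < σ := by positivity
  have hσ1 : σ ≤ 1 + 4 * δ := by
    rw [hσ, div_le_iff₀ hq1]
    nlinarith
  obtain ⟨X₀, hX₀⟩ := exists_two_pow_mul_pow_near hq0 hqc
  filter_upwards [Filter.eventually_ge_atTop ⌈X₀ * σ⌉₊] with n hn
  obtain ⟨a, r, hr, hle, hlt⟩ := hX₀ (n / σ) (by
    rw [ge_iff_le, le_div_iff₀ hσ0]
    exact Nat.ceil_le.mp hn)
  have hk0 : 2 ^ a * q ^ r ≠ 0 := by positivity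
  refine ⟨2 ^ a * q ^ r, hk0, ?_, ?_⟩
  · have : Fact (Nat.Prime 3) := ⟨Nat.prime_three⟩
    let F := GaloisField 3 b
    have : Fintype F := Fintype.ofFinite F
    have hF : Fintype.card F = q := by
      rw [← Nat.card_eq_fintype_card]
      exact GaloisField.card 3 b hb
    have h1 : HasDomatic (2 ^ (a + c) - 1) (2 ^ a * Fintype.card F) := by
      refine (hasDomatic_hamming (a + c)).mono le_rfl ?_ ?_
      · rw [hF, pow_add]
        exact Nat.mul_le_mul_left _ hqc.le
      · rw [hF]; positivity
    have h2 := h1.lines F (by positivity) hr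
    rw [hF] at h2
    refine h2.mono ?_ le_rfl hk0
    have hP := Projectivization.card' F (Fin r → F)
    rw [Nat.card_eq_fintype_card (α := Fin r → F), Nat.card_eq_fintype_card (α := F),
      Fintype.card_fun, hF, Fintype.card_fin] at hP
    set P := Nat.card (Projectivization F (Fin r → F))
    have hP' : (q : ℝ) ^ r = P * (q - 1) + 1 := by
      have : ((q - 1 : ℕ) : ℝ) = q - 1 := by rw [Nat.cast_sub hq0]; simp
      rw [← this]
      exact_mod_cast hP
    have hlen : ((P * (2 ^ (a + c) - 1) : ℕ) : ℝ) ≤ n := by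
      have h3 : ((2 ^ (a + c) - 1 : ℕ) : ℝ) ≤ 2 ^ (a + c) := by
        exact_mod_cast Nat.sub_le _ _
      rw [le_div_iff₀ hσ0] at hle
      calc ((P * (2 ^ (a + c) - 1) : ℕ) : ℝ) ≤ P * 2 ^ (a + c) := by
            push_cast only [Nat.cast_mul]
            gcongr
        _ = 2 ^ a * (P * (q - 1)) * σ := by
            rw [hσ, pow_add]
            field_simp
        _ ≤ 2 ^ a * q ^ r * σ := by
            rw [hP']
            gcongr
            linarith
        _ ≤ n := hle
    exact_mod_cast hlen
  · rw [div_lt_iff₀ hσ0] at hlt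
    have h1 : (2 : ℝ) ^ c / q ≤ 1 + δ := by rwa [div_le_iff₀ hqr]
    have h2 : 2 ^ c / (q : ℝ) * σ ≤ 1 + ε := by
      calc 2 ^ c / (q : ℝ) * σ ≤ (1 + δ) * (1 + 4 * δ) := by gcongr
        _ ≤ 1 + ε := by nlinarith
    push_cast
    calc (n : ℝ) ≤ 2 ^ c / q * (2 ^ a * q ^ r) * σ := hlt.le
      _ = 2 ^ c / q * σ * (2 ^ a * q ^ r) := by ring
      _ ≤ (1 + ε) * (2 ^ a * q ^ r) := by gcongr

/-! ### The recursive inequality for the density -/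

/-- The density of an optimal covering code of length `n` and covering radius at most `R`. -/
noncomputable def coverDensity (n R : ℕ) : ℝ :=
  coverNum n R * (binomLE n R / 2 ^ n)

theorem coverDensity_nonneg (n R : ℕ) : 0 ≤ coverDensity n R := by
  unfold coverDensity; positivity

/-- The recursive inequality for the density. With `s * 2 ^ y / V` greedily chosen balls of size
`V` in `Q_y`, at most a proportion `exp (-s)` of `Q_y` is missed, and above the missed points an
optimal code of radius `R` in `Q_x` is used. -/
theorem coverDensity_add_le {x y R k : ℕ} {s ε : ℝ} (hR : R ≠ 0) (hs : 0 ≤ s)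
    (hx : x ≠ 0) (hk : k ≠ 0) (h : HasDomatic x k) (hxk : (x : ℝ) ≤ (1 + ε) * k) :
    coverDensity (x + y) R ≤
      (1 + ε) * (binomLE (x + y) R / (x * binomLE y (R - 1))) *
          (s + binomLE y (R - 1) / 2 ^ y)
        + Real.exp (-s) * (binomLE (x + y) R / binomLE x R) * coverDensity x R := by
  set V : ℝ := (binomLE y (R - 1) : ℝ) with hV
  have hV0 : 0 < V := by rw [hV]; exact_mod_cast binomLE_pos _ _
  have hx0 : (0 : ℝ) < x := by exact_mod_cast Nat.pos_of_ne_zero hx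
  have hk0 : (0 : ℝ) < k := by exact_mod_cast Nat.pos_of_ne_zero hk
  have hW0 : (0 : ℝ) < binomLE x R := by exact_mod_cast binomLE_pos _ _
  set t : ℕ := ⌈s * 2 ^ y / V⌉₊ with ht
  obtain ⟨B, hB, hT⟩ := exists_uncovered_card_le y (R - 1) t
  have hB' : (B.card : ℝ) ≤ 2 ^ y / V * (s + V / 2 ^ y) := by
    calc (B.card : ℝ) ≤ t := by exact_mod_cast hB
      _ ≤ s * 2 ^ y / V + 1 := (Nat.ceil_lt_add_one (by positivity)).le
      _ = 2 ^ y / V * (s + V / 2 ^ y) := by field_simp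
  have hT' : ((uncovered B (R - 1)).card : ℝ) ≤ 2 ^ y * Real.exp (-s) := by
    refine hT.trans ?_
    have hle : 0 ≤ 1 - V / 2 ^ y := by
      rw [sub_nonneg, div_le_one (by positivity), hV]
      exact binomLE_le_two_pow y (R - 1)
    gcongr
    calc (1 - V / 2 ^ y) ^ t ≤ Real.exp (-(V / 2 ^ y)) ^ t := by
          gcongr
          linarith [Real.add_one_le_exp (-(V / 2 ^ y))]
      _ = Real.exp (-(V / 2 ^ y * t)) := by
          rw [← Real.exp_nat_mul]; congr 1; ring
      _ ≤ Real.exp (-s) := by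
          have h1 : s * 2 ^ y / V ≤ t := Nat.le_ceil _
          have h2 : V / 2 ^ y * (s * 2 ^ y / V) ≤ V / 2 ^ y * t := by gcongr
          have h3 : V / 2 ^ y * (s * 2 ^ y / V) = s := by field_simp
          rw [Real.exp_le_exp]
          linarith
  have hH : (coverNum x 1 : ℝ) ≤ (1 + ε) * (2 ^ x / x) := by
    have h1 : (coverNum x 1 : ℝ) * k ≤ 2 ^ x := by exact_mod_cast h.coverNum_mul_le
    rw [← mul_div_assoc, le_div_iff₀ hx0]
    calc (coverNum x 1 : ℝ) * x ≤ coverNum x 1 * ((1 + ε) * k) := by gcongr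
      _ = (1 + ε) * (coverNum x 1 * k) := by ring
      _ ≤ (1 + ε) * 2 ^ x := by
        have : 0 ≤ 1 + ε := by
          by_contra! h0
          nlinarith
        gcongr
  have hmain : (coverNum (x + y) R : ℝ) ≤
      coverNum x 1 * B.card + coverNum x R * (uncovered B (R - 1)).card := by
    exact_mod_cast coverNum_add_le hR B
  have hε : 0 ≤ (1 + ε) * (2 ^ x / x) := le_trans (by positivity) hH
  calc coverDensity (x + y) R
      ≤ (((1 + ε) * (2 ^ x / x)) * (2 ^ y / V * (s + V / 2 ^ y))
          + coverNum x R * (2 ^ y * Real.exp (-s))) * (binomLE (x + y) R / 2 ^ (x + y)) := by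
        unfold coverDensity
        gcongr
        refine hmain.trans ?_
        gcongr
    _ = _ := by
        unfold coverDensity
        rw [pow_add]
        field_simp

/-! ### Asymptotics of the size of a Hamming ball -/


theorem tendsto_choose_div_pow (k : ℕ) :
    Tendsto (fun n : ℕ => (n.choose k : ℝ) / n ^ k) atTop (𝓝 (1 / k.factorial)) := by
  have h := (isEquivalent_choose k).div
    (Asymptotics.IsEquivalent.refl (u := fun n : ℕ => (n : ℝ) ^ k) (l := atTop))
  refine h.symm.tendsto_nhds (tendsto_const_nhds.congr' ?_)
  filter_upwards [eventually_gt_atTop 0] with n hn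
  have : (n : ℝ) ≠ 0 := by exact_mod_cast hn.ne'
  simp only [Pi.div_apply]
  field_simp

theorem tendsto_binomLE_div_pow (R : ℕ) :
    Tendsto (fun n : ℕ => (binomLE n R : ℝ) / n ^ R) atTop (𝓝 (1 / R.factorial)) := by
  induction R with
  | zero => simp [binomLE]
  | succ R ih =>
    have h := (ih.mul (tendsto_one_div_atTop_nhds_zero_nat (𝕜 := ℝ))).add
      (tendsto_choose_div_pow (R + 1))
    rw [mul_zero, zero_add] at h
    refine h.congr fun n => ?_
    have : binomLE n (R + 1) = binomLE n R + n.choose (R + 1) := by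
      simp only [binomLE, Finset.sum_range_succ]
    rw [this, Nat.cast_add, add_div, pow_succ, div_mul_div_comm, mul_one]

theorem tendsto_natDiv_div (R : ℕ) :
    Tendsto (fun n : ℕ => ((n / R : ℕ) : ℝ) / n) atTop (𝓝 (1 / R)) := by
  have h := (tendsto_nat_floor_mul_div_atTop (R := ℝ) (a := 1 / R) (by positivity)).comp
    (tendsto_natCast_atTop_atTop (R := ℝ))
  refine h.congr fun n => ?_
  simp only [Function.comp]
  rw [one_div_mul_eq_div, Nat.floor_div_eq_div]

theorem tendsto_sub_natDiv_div (R : ℕ) :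
    Tendsto (fun n : ℕ => ((n - n / R : ℕ) : ℝ) / n) atTop (𝓝 (1 - 1 / R)) := by
  refine ((tendsto_const_nhds (x := (1 : ℝ))).sub (tendsto_natDiv_div R)).congr' ?_
  filter_upwards [eventually_gt_atTop 0] with n hn
  have : (n : ℝ) ≠ 0 := by exact_mod_cast hn.ne'
  rw [Nat.cast_sub (Nat.div_le_self n R), sub_div, div_self this]

theorem tendsto_natDiv_atTop {R : ℕ} (hR : 2 ≤ R) :
    Tendsto (fun n : ℕ => n / R) atTop atTop :=
  Nat.tendsto_div_const_atTop (by omega)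

theorem tendsto_sub_natDiv_atTop {R : ℕ} (hR : 2 ≤ R) :
    Tendsto (fun n : ℕ => n - n / R) atTop atTop := by
  refine tendsto_atTop_mono (fun n => ?_) (tendsto_natDiv_atTop hR)
  have := Nat.div_mul_le_self n R
  have : n / R * 2 ≤ n / R * R := Nat.mul_le_mul_left _ hR
  omega

theorem tendsto_binomLE_div_binomLE_natDiv {R : ℕ} (hR : 2 ≤ R) :
    Tendsto (fun n : ℕ => (binomLE n R : ℝ) / binomLE (n / R) R) atTop (𝓝 (R ^ R)) := by
  have hf : (1 / R.factorial : ℝ) ≠ 0 := by positivity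
  have hR0 : (1 / R : ℝ) ≠ 0 := by
    have : (R : ℝ) ≠ 0 := by exact_mod_cast (by omega : R ≠ 0)
    positivity
  have h := ((tendsto_binomLE_div_pow R).div
    ((tendsto_binomLE_div_pow R).comp (tendsto_natDiv_atTop hR)) hf).div
    ((tendsto_natDiv_div R).pow R) (pow_ne_zero R hR0)
  have hlim : (1 / R.factorial : ℝ) / (1 / R.factorial) / (1 / R) ^ R = R ^ R := by
    rw [div_self hf]; simp
  rw [hlim] at h
  refine h.congr' ?_
  filter_upwards [(tendsto_natDiv_atTop hR).eventually_gt_atTop 0, eventually_gt_atTop 0]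
    with n hn hn0
  have h1 : (n : ℝ) ≠ 0 := by exact_mod_cast hn0.ne'
  have h2 : ((n / R : ℕ) : ℝ) ≠ 0 := by exact_mod_cast hn.ne'
  have h3 : (binomLE (n / R) R : ℝ) ≠ 0 := by exact_mod_cast (binomLE_pos _ _).ne'
  simp only [Pi.div_apply, Function.comp, div_pow]
  field_simp

/-- The loss caused by the splitting of `n` coordinates into `n / R` and `n - n / R`. -/
theorem tendsto_binomLE_div_mul {R : ℕ} (hR : 2 ≤ R) :
    Tendsto (fun n : ℕ => (binomLE n R : ℝ) /
      ((n / R : ℕ) * binomLE (n - n / R) (R - 1))) atTop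
      (𝓝 ((1 + 1 / ((R - 1 : ℕ) : ℝ)) ^ (R - 1))) := by
  obtain ⟨k, rfl⟩ : ∃ k, R = k + 1 := ⟨R - 1, by omega⟩
  have hk : (k : ℝ) ≠ 0 := by exact_mod_cast (by omega : k ≠ 0)
  have hk1 : (k : ℝ) + 1 ≠ 0 := by positivity
  rw [Nat.add_sub_cancel]
  have hf : (1 / k.factorial : ℝ) ≠ 0 := by positivity
  have hR0 : (1 / (k + 1 : ℕ) : ℝ) ≠ 0 := by positivity
  have hR1 : (1 - 1 / (k + 1 : ℕ) : ℝ) ≠ 0 := by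
    push_cast
    field_simp
    simp [hk, hk1]
  have h := (((tendsto_binomLE_div_pow (k + 1)).div
    ((tendsto_binomLE_div_pow k).comp (tendsto_sub_natDiv_atTop hR)) hf).div
    (tendsto_natDiv_div (k + 1)) hR0).div
    ((tendsto_sub_natDiv_div (k + 1)).pow k) (pow_ne_zero k hR1)
  have hlim : (1 / (k + 1).factorial : ℝ) / (1 / k.factorial) / (1 / (k + 1 : ℕ)) /
      (1 - 1 / (k + 1 : ℕ)) ^ k = (1 + 1 / (k : ℝ)) ^ k := by
    have h1 : (1 - 1 / (k + 1 : ℕ) : ℝ) = k / (k + 1) := by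
      push_cast; field_simp; ring
    have h2 : (1 + 1 / (k : ℝ)) = (k + 1) / k := by field_simp
    rw [h1, h2, Nat.factorial_succ, div_pow, div_pow]
    push_cast
    field_simp
  rw [hlim] at h
  refine h.congr' ?_
  filter_upwards [(tendsto_natDiv_atTop hR).eventually_gt_atTop 0, eventually_gt_atTop 0,
    (tendsto_sub_natDiv_atTop hR).eventually_gt_atTop 0] with n hn hn0 hn1
  have h1 : (n : ℝ) ≠ 0 := by exact_mod_cast hn0.ne'
  have h2 : ((n / (k + 1) : ℕ) : ℝ) ≠ 0 := by exact_mod_cast hn.ne'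
  have h3 : ((n - n / (k + 1) : ℕ) : ℝ) ≠ 0 := by exact_mod_cast hn1.ne'
  have h4 : (binomLE (n - n / (k + 1)) k : ℝ) ≠ 0 := by exact_mod_cast (binomLE_pos _ _).ne'
  simp only [Pi.div_apply, Function.comp, div_pow]
  field_simp
  ring

theorem tendsto_binomLE_div_two_pow (R : ℕ) :
    Tendsto (fun n : ℕ => (binomLE n R : ℝ) / 2 ^ n) atTop (𝓝 0) := by
  have h := (tendsto_binomLE_div_pow R).mul
    (tendsto_pow_const_div_const_pow_of_one_lt R (one_lt_two (α := ℝ)))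
  rw [mul_zero] at h
  refine h.congr' ?_
  filter_upwards [eventually_gt_atTop 0] with n hn
  have : (n : ℝ) ≠ 0 := by exact_mod_cast hn.ne'
  field_simp

theorem tendsto_binomLE_succ_div (R : ℕ) :
    Tendsto (fun n : ℕ => (binomLE (n + 1) R : ℝ) / binomLE n R) atTop (𝓝 1) := by
  have hf : (1 / R.factorial : ℝ) ≠ 0 := by positivity
  have h0 : Tendsto (fun n : ℕ => ((n + 1 : ℕ) : ℝ) / n) atTop (𝓝 1) := by
    have := (tendsto_const_nhds (x := (1 : ℝ))).add
      (tendsto_one_div_atTop_nhds_zero_nat (𝕜 := ℝ))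
    rw [add_zero] at this
    refine this.congr' ?_
    filter_upwards [eventually_gt_atTop 0] with n hn
    have : (n : ℝ) ≠ 0 := by exact_mod_cast hn.ne'
    push_cast
    field_simp
  have h := (((tendsto_binomLE_div_pow R).comp (tendsto_add_atTop_nat 1)).div
    (tendsto_binomLE_div_pow R) hf).mul (h0.pow R)
  rw [div_self hf, one_pow, mul_one] at h
  refine h.congr' ?_
  filter_upwards [eventually_gt_atTop 0] with n hn
  have h1 : (n : ℝ) ≠ 0 := by exact_mod_cast hn.ne'
  have h2 : ((n + 1 : ℕ) : ℝ) ≠ 0 := by positivity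
  have h3 : (binomLE n R : ℝ) ≠ 0 := by exact_mod_cast (binomLE_pos _ _).ne'
  simp only [Pi.div_apply, Function.comp, div_pow]
  field_simp

theorem tendsto_binomLE_pred_div {R : ℕ} (hR : R ≠ 0) :
    Tendsto (fun n : ℕ => (binomLE n (R - 1) : ℝ) / binomLE n R) atTop (𝓝 0) := by
  obtain ⟨k, rfl⟩ : ∃ k, R = k + 1 := ⟨R - 1, by omega⟩
  have h := ((tendsto_binomLE_div_pow k).div (tendsto_binomLE_div_pow (k + 1))
    (by positivity)).mul (tendsto_one_div_atTop_nhds_zero_nat (𝕜 := ℝ))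
  rw [mul_zero] at h
  refine h.congr' ?_
  filter_upwards [eventually_gt_atTop 0] with n hn
  have h1 : (n : ℝ) ≠ 0 := by exact_mod_cast hn.ne'
  have h3 : (binomLE n (k + 1) : ℝ) ≠ 0 := by exact_mod_cast (binomLE_pos _ _).ne'
  simp only [Pi.div_apply, Nat.add_sub_cancel]
  field_simp
  ring

/-! ### Solving the recursion -/

theorem exists_forall_le_of_le_natDiv {f : ℕ → ℝ} {α β : ℝ} {R N : ℕ} (hR : 2 ≤ R) (hβ0 : 0 ≤ β)
    (hβ1 : β < 1) (h : ∀ n ≥ N, f n ≤ α + β * f (n / R)) :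
    ∃ B, ∀ n, f n ≤ B := by
  refine ⟨max (α / (1 - β)) (∑ i ∈ Finset.range (N + 1), |f i|), fun n => ?_⟩
  set B := max (α / (1 - β)) (∑ i ∈ Finset.range (N + 1), |f i|) with hB
  have hαB : α + β * B ≤ B := by
    have h1 : α / (1 - β) ≤ B := le_max_left _ _
    rw [div_le_iff₀ (by linarith)] at h1
    linarith
  induction n using Nat.strong_induction_on with
  | _ n ih =>
    by_cases hn : n ≤ N
    · refine le_trans ?_ (le_max_right _ _)
      exact (le_abs_self _).trans (Finset.single_le_sum (f := fun i => |f i|)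
        (fun i _ => abs_nonneg _) (Finset.mem_range.mpr (by omega)))
    · have hlt : n / R < n := Nat.div_lt_self (by omega) (by omega)
      have h1 := h n (by omega)
      have h2 : β * f (n / R) ≤ β * B := mul_le_mul_of_nonneg_left (ih _ hlt) hβ0
      linarith

/-- A sequence with `f n ≤ α + β f (n / R)` for large `n` has upper limit at most the fixed point
`α / (1 - β)`; no bound on `f` has to be known beforehand. -/
theorem eventually_le_of_le_natDiv {f : ℕ → ℝ} {α β M : ℝ} {R : ℕ} (hR : 2 ≤ R) (hβ0 : 0 ≤ β)
    (hβ1 : β < 1) (h : ∀ᶠ n in atTop, f n ≤ α + β * f (n / R)) (hM : α / (1 - β) < M) :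
    ∀ᶠ n in atTop, f n ≤ M := by
  obtain ⟨N, hN⟩ := eventually_atTop.mp h
  obtain ⟨B, hB⟩ := exists_forall_le_of_le_natDiv hR hβ0 hβ1 hN
  set L := α / (1 - β) with hL
  have hfix : α + β * L = L := by
    have : (1 - β) ≠ 0 := by linarith
    rw [hL]; field_simp; ring
  have hstep : ∀ j : ℕ, ∀ᶠ n in atTop, f n ≤ L + β ^ j * (B - L) := by
    intro j
    induction j with
    | zero => exact Eventually.of_forall fun n => by simpa using hB n
    | succ j ih =>
      filter_upwards [h, (tendsto_natDiv_atTop hR).eventually ih] with n h1 h2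
      have h3 := mul_le_mul_of_nonneg_left h2 hβ0
      calc f n ≤ α + β * (L + β ^ j * (B - L)) := by linarith
        _ = (α + β * L) + β ^ (j + 1) * (B - L) := by ring
        _ = _ := by rw [hfix]
  have hlim : Tendsto (fun j : ℕ => L + β ^ j * (B - L)) atTop (𝓝 (L + 0 * (B - L))) :=
    ((tendsto_pow_atTop_nhds_zero_of_lt_one hβ0 hβ1).mul_const _).const_add _
  rw [zero_mul, add_zero] at hlim
  obtain ⟨j, hj⟩ := (hlim.eventually_lt_const hM).exists
  filter_upwards [hstep j] with n hn
  exact hn.trans hj.le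

theorem one_add_one_div_pow_lt_exp {k : ℕ} (hk : k ≠ 0) :
    (1 + 1 / (k : ℝ)) ^ k < Real.exp 1 := by
  have hk0 : (0 : ℝ) < k := by exact_mod_cast Nat.pos_of_ne_zero hk
  have h1 : 1 + 1 / (k : ℝ) < Real.exp (1 / k) := by
    linarith [Real.add_one_lt_exp (x := 1 / (k : ℝ)) (by positivity)]
  calc (1 + 1 / (k : ℝ)) ^ k < Real.exp (1 / k) ^ k := by gcongr
    _ = Real.exp 1 := by rw [← Real.exp_nat_mul]; congr 1; field_simp

/-- The strict inequality `(1 + 1 / (R - 1)) ^ (R - 1) < e` absorbs all error terms. -/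
theorem eventually_coverDensity_le {R : ℕ} (hR : 2 ≤ R) {s β : ℝ} (hs : 0 < s)
    (hβ : Real.exp (-s) * R ^ R < β) :
    ∀ᶠ n in atTop, coverDensity n R ≤ Real.exp 1 * s + β * coverDensity (n / R) R := by
  set a : ℝ := (1 + 1 / ((R - 1 : ℕ) : ℝ)) ^ (R - 1) with ha
  have ha0 : 0 < a := by positivity
  have hae : a < Real.exp 1 := one_add_one_div_pow_lt_exp (by omega)
  obtain ⟨ε, hε, hεa⟩ : ∃ ε > 0, (1 + ε) * a < Real.exp 1 := by
    refine ⟨(Real.exp 1 / a - 1) / 2, ?_, ?_⟩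
    · have : 1 < Real.exp 1 / a := by rwa [one_lt_div ha0]
      linarith
    · have : Real.exp 1 / a * a = Real.exp 1 := div_mul_cancel₀ _ ha0.ne'
      nlinarith
  have h1 : Tendsto (fun n : ℕ => (1 + ε) * ((binomLE n R : ℝ) /
      ((n / R : ℕ) * binomLE (n - n / R) (R - 1))) *
      (s + binomLE (n - n / R) (R - 1) / 2 ^ (n - n / R))) atTop
      (𝓝 ((1 + ε) * a * (s + 0))) :=
    ((tendsto_binomLE_div_mul hR).const_mul _).mul
      (((tendsto_binomLE_div_two_pow (R - 1)).comp (tendsto_sub_natDiv_atTop hR)).const_add s)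
  have h2 := (tendsto_binomLE_div_binomLE_natDiv hR).const_mul (Real.exp (-s))
  have hlt : (1 + ε) * a * (s + 0) < Real.exp 1 * s := by
    rw [add_zero]; gcongr
  filter_upwards [h1.eventually_lt_const hlt, h2.eventually_lt_const hβ,
    (tendsto_natDiv_atTop hR).eventually (eventually_hasDomatic hε),
    (tendsto_natDiv_atTop hR).eventually_gt_atTop 0] with n hn1 hn2 hn3 hn4
  obtain ⟨k, hk, hdom, hnk⟩ := hn3
  have hn : n / R + (n - n / R) = n := Nat.add_sub_cancel' (Nat.div_le_self n R)
  have h := coverDensity_add_le (y := n - n / R) (by omega : R ≠ 0) hs.le hn4.ne' hk hdom hnk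
  rw [hn] at h
  refine h.trans (add_le_add hn1.le ?_)
  exact mul_le_mul_of_nonneg_right hn2.le (coverDensity_nonneg _ _)

theorem five_lt_exp_two : 5 < Real.exp 2 := by
  have h : Real.exp 2 = Real.exp 1 * Real.exp 1 := by rw [← Real.exp_add]; norm_num
  rw [h]
  nlinarith [Real.exp_one_gt_d9]

/-- The upper limit of the density of covering codes is smaller than the bound to be proved. The
proportion `exp (-s)` of greedily uncovered points is taken to be
`exp (-2) / (R ^ R * R * log R)`, so that the recursion contracts by a factor of order
`1 / (R * log R)`. -/
theorem exists_eventually_coverDensity_le {R : ℕ} (hR : 2 ≤ R) :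
    ∃ M < Real.exp 1 * ((R : ℝ) * Real.log R + Real.log R + Real.log (Real.log R) + 4),
      0 < M ∧ ∀ᶠ n in atTop, coverDensity n R ≤ M := by
  have hR' : (2 : ℝ) ≤ R := by exact_mod_cast hR
  have hl2 : (0.69 : ℝ) < Real.log 2 := by linarith [Real.log_two_gt_d9]
  have hl : Real.log 2 ≤ Real.log R := Real.log_le_log (by norm_num) hR'
  have hl0 : 0 < Real.log R := by linarith
  have hll1 : Real.log (Real.log R) ≤ Real.log R := by
    linarith [Real.log_le_sub_one_of_pos hl0]
  have hll2 : -Real.log R ≤ Real.log (Real.log R) := by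
    have h1 : Real.log (1 / 2) ≤ Real.log (Real.log R) :=
      Real.log_le_log (by norm_num) (by linarith)
    rw [one_div, Real.log_inv] at h1
    linarith
  set P : ℝ := R * Real.log R with hP
  have hP1 : 2 * Real.log R ≤ P := by rw [hP]; gcongr
  have hP0 : 0 < P := by linarith
  set s : ℝ := P + Real.log R + Real.log (Real.log R) + 2 with hs
  have hs0 : 0 < s := by linarith
  -- Twice the limiting coefficient `exp (-s) * R ^ R`, to leave room for the error terms.
  set β : ℝ := 2 / (Real.exp 2 * P) with hβ
  have hβ0 : 0 < β := by positivity
  have hexp : Real.exp (-s) * R ^ R < β := by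
    have h1 : Real.exp s = R ^ R * P * Real.exp 2 := by
      rw [hs, Real.exp_add, Real.exp_add, Real.exp_add, Real.exp_log hl0,
        Real.exp_log (by linarith), hP, Real.exp_nat_mul, Real.exp_log (by linarith)]
      ring
    have hRR : (0 : ℝ) < R ^ R := by positivity
    rw [Real.exp_neg, h1, hβ]
    rw [show ((R : ℝ) ^ R * P * Real.exp 2)⁻¹ * R ^ R = 1 / (Real.exp 2 * P) by field_simp]
    gcongr
    norm_num
  have hβs : β * (s + 2) < 2 := by
    rw [hβ, div_mul_eq_mul_div, div_lt_iff₀ (by positivity)]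
    have h5 := five_lt_exp_two
    nlinarith
  have hβ1 : β < 1 := by nlinarith
  have hlt : Real.exp 1 * s / (1 - β) < Real.exp 1 * (s + 2) := by
    rw [div_lt_iff₀ (by linarith), mul_assoc]
    gcongr
    nlinarith
  obtain ⟨M, hM1, hM2⟩ := exists_between hlt
  refine ⟨M, ?_, ?_, ?_⟩
  · calc M < _ := hM2
      _ = _ := by rw [hs]; ring
  · refine lt_trans ?_ hM1
    have : 0 < 1 - β := by linarith
    positivity
  · exact eventually_le_of_le_natDiv hR hβ0.le hβ1 (eventually_coverDensity_le hR hs0 hexp) hM1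

/-! ### Normal codes -/

/-- Appending an arbitrary first coordinate to the words of a covering code. -/
def prefixCode {n : ℕ} (C : Finset (Cube n)) : Finset (Cube (n + 1)) :=
  Finset.univ.filter fun w => Fin.tail w ∈ C

theorem card_prefixCode {n : ℕ} (C : Finset (Cube n)) : (prefixCode C).card = 2 * C.card := by
  have : (prefixCode C).card = ((Finset.univ : Finset (ZMod 2)) ×ˢ C).card := by
    refine Finset.card_bij' (fun w _ => (w 0, Fin.tail w)) (fun p _ => Fin.cons p.1 p.2)
      ?_ ?_ ?_ ?_
    · intro w hw
      simpa [prefixCode] using hw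
    · intro p hp
      simpa [prefixCode] using hp
    · intro w _
      exact Fin.cons_self_tail w
    · intro p _
      simp
  rw [this, Finset.card_product]
  simp [ZMod.card]

theorem hammingDist_cons {n : ℕ} (w : Cube (n + 1)) (b : ZMod 2) (c : Cube n) :
    hammingDist w (Fin.cons b c : Cube (n + 1)) =
      (if w 0 = b then 0 else 1) + hammingDist (Fin.tail w) c := by
  have h1 : hammingDist (Fin.tail w) c = ∑ i, if w i.succ ≠ c i then 1 else 0 :=
    Finset.card_filter _ _
  rw [h1, hammingDist, Finset.card_filter, Fin.sum_univ_succ]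
  congr 1
  by_cases h : w 0 = b <;> simp [h]

theorem Covers.covers_prefixCode {n R : ℕ} {C : Finset (Cube n)} (h : Covers C R) :
    Covers (prefixCode C) R := by
  intro w
  obtain ⟨c, hc, hd⟩ := h (Fin.tail w)
  exact ⟨Fin.cons (w 0) c, by simpa [prefixCode] using hc,
    by simpa [hammingDist_cons] using hd⟩

theorem distToSet_le {n : ℕ} {x y : Cube n} {Y : Finset (Cube n)} (hy : y ∈ Y) :
    distToSet x Y ≤ hammingDist x y :=
  iInf₂_le y hy

/-- The two halves of the prefixed code are copies of `C`. One is at distance at most `R` from a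
given word, the other at distance at most `R + 1`. -/
theorem Covers.normAt_prefixCode_le {n R : ℕ} {C : Finset (Cube n)} (h : Covers C R) :
    normAt (prefixCode C) 0 ≤ ((2 * R + 1 : ℕ) : ℕ∞) := by
  refine iSup_le fun w => ?_
  obtain ⟨c, hc, hd⟩ := h (Fin.tail w)
  have hb : ∀ b : ZMod 2, distToSet w (codeSlice (prefixCode C) 0 b) ≤
      (((if w 0 = b then 0 else 1) + R : ℕ) : ℕ∞) := by
    intro b
    refine (distToSet_le (y := Fin.cons b c) (by simp [codeSlice, prefixCode, hc])).trans ?_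
    rw [hammingDist_cons]
    exact_mod_cast Nat.add_le_add_left hd _
  refine (add_le_add (hb 0) (hb 1)).trans ?_
  rw [← Nat.cast_add]
  have h01 : ∀ a : ZMod 2, a = 0 ∨ a = 1 := by decide
  refine Nat.cast_le.mpr ?_
  rcases h01 (w 0) with h0 | h0 <;> simp [h0] <;> omega

/-- A prefixed covering code is normal as soon as it is too small to have covering radius less
than `R`. -/
theorem Covers.isNormalCode_prefixCode {n R : ℕ} {C : Finset (Cube n)} (h : Covers C R)
    (hsize : (prefixCode C).card * binomLE (n + 1) (R - 1) < 2 ^ (n + 1)) :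
    IsNormalCode (prefixCode C) R := by
  have hnot : ¬ Covers (prefixCode C) (R - 1) := fun hc => hsize.not_ge hc.two_pow_le
  have hrad : HasCoveringRadius (prefixCode C) R := by
    refine ⟨h.covers_prefixCode, fun r hr => ?_⟩
    by_contra! hlt
    refine hnot fun x => ?_
    obtain ⟨c, hc, hd⟩ := hr x
    exact ⟨c, hc, by omega⟩
  have hnorm : HasNorm (prefixCode C) (2 * R + 1) :=
    (iInf_le _ 0).trans h.normAt_prefixCode_le
  obtain ⟨x, hx⟩ : ∃ x, ∀ c ∈ prefixCode C, R ≤ hammingDist x c := by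
    unfold Covers at hnot
    push Not at hnot
    obtain ⟨x, hx⟩ := hnot
    exact ⟨x, fun c hc => by have := hx c hc; omega⟩
  have hlow : ((2 * R : ℕ) : ℕ∞) ≤ minNorm (prefixCode C) := by
    refine le_iInf fun i => ?_
    have hb : ∀ b, (R : ℕ∞) ≤ distToSet x (codeSlice (prefixCode C) i b) := by
      intro b
      refine le_iInf₂ fun y hy => ?_
      exact_mod_cast hx y (Finset.mem_of_mem_filter y hy)
    calc ((2 * R : ℕ) : ℕ∞) = R + R := by push_cast; ring
      _ ≤ _ := add_le_add (hb 0) (hb 1)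
      _ ≤ _ := le_iSup (fun x => distToSet x (codeSlice (prefixCode C) i 0)
          + distToSet x (codeSlice (prefixCode C) i 1)) x
  refine ⟨hrad, hnorm, ?_⟩
  unfold HasNorm at hnorm
  obtain ⟨m, hm⟩ := ENat.ne_top_iff_exists.mp (ne_top_of_le_ne_top (ENat.natCast_ne_top _) hnorm)
  rw [← hm] at hnorm hlow ⊢
  have h1 : m ≤ 2 * R + 1 := by exact_mod_cast hnorm
  have h2 : 2 * R ≤ m := by exact_mod_cast hlow
  have h3 : m = 2 * R + 1 ∨ m = 2 * R := by omega
  exact h3.imp (fun h => by rw [h]) (fun h => by rw [h])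

theorem IsNormalCode.normalDensity_le {n R : ℕ} {C : Finset (Cube n)} (h : IsNormalCode C R)
    {M : ℝ} (hM : C.card * (binomLE n R / 2 ^ n : ℝ) ≤ M) :
    normalDensity n R ≤ ENNReal.ofReal M := by
  have hV : (0 : ℝ) < binomLE n R := by exact_mod_cast binomLE_pos n R
  have h1 : minNormalCodeSize n R ≤ C.card := iInf₂_le C h
  have h2 : (minNormalCodeSize n R : ℝ≥0∞) ≤ (C.card : ℝ≥0∞) := by
    have := ENat.toENNReal_le.mpr h1
    simpa using this
  calc normalDensity n R ≤ (C.card : ℝ≥0∞) / (2 ^ n / (binomLE n R : ℝ≥0∞)) :=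
        ENNReal.div_le_div_right h2 _
    _ = ENNReal.ofReal (C.card / (2 ^ n / binomLE n R)) := by
        rw [ENNReal.ofReal_div_of_pos (by positivity), ENNReal.ofReal_div_of_pos hV,
          ENNReal.ofReal_natCast, ENNReal.ofReal_natCast, ENNReal.ofReal_pow (by norm_num)]
        simp
    _ ≤ ENNReal.ofReal M := by
        refine ENNReal.ofReal_le_ofReal (le_trans (le_of_eq ?_) hM)
        field_simp

theorem theorem3p1 (R : ℕ) (hR : 2 ≤ R) :
    normalDensityStar R ≤
      ENNReal.ofReal (Real.exp 1 *
        ((R : ℝ) * Real.log (R : ℝ) + Real.log (R : ℝ) + Real.log (Real.log (R : ℝ)) + 4)) := by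
  set T : ℝ := Real.exp 1 *
    ((R : ℝ) * Real.log (R : ℝ) + Real.log (R : ℝ) + Real.log (Real.log (R : ℝ)) + 4)
  obtain ⟨M, hMT, hM0, hM⟩ := exists_eventually_coverDensity_le hR
  change M < T at hMT
  have hT0 : 0 < T := hM0.trans hMT
  have hR0 : R ≠ 0 := by omega
  have hratio : ∀ᶠ n : ℕ in atTop, (binomLE (n + 1) R : ℝ) / binomLE n R < T / M :=
    (tendsto_binomLE_succ_div R).eventually_lt_const ((one_lt_div hM0).mpr hMT)
  have hpred : ∀ᶠ n : ℕ in atTop,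
      (binomLE (n + 1) (R - 1) : ℝ) / binomLE (n + 1) R < 1 / T :=
    ((tendsto_binomLE_pred_div hR0).comp (tendsto_add_atTop_nat 1)).eventually_lt_const
      (by positivity)
  have key : ∀ᶠ n : ℕ in atTop, normalDensity (n + 1) R ≤ ENNReal.ofReal T := by
    filter_upwards [hM, hratio, hpred] with n h1 h2 h3
    obtain ⟨C, hC, hcard⟩ := exists_covers_card_eq n R
    have hV : (0 : ℝ) < binomLE n R := by exact_mod_cast binomLE_pos n R
    have hV1 : (0 : ℝ) < binomLE (n + 1) R := by exact_mod_cast binomLE_pos _ R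
    have hW1 : (0 : ℝ) < binomLE (n + 1) (R - 1) := by exact_mod_cast binomLE_pos _ _
    have hdens : ((prefixCode C).card : ℝ) * (binomLE (n + 1) R / 2 ^ (n + 1)) ≤ T := by
      calc ((prefixCode C).card : ℝ) * (binomLE (n + 1) R / 2 ^ (n + 1))
          = coverDensity n R * (binomLE (n + 1) R / binomLE n R) := by
            rw [card_prefixCode, hcard, coverDensity, pow_succ]
            push_cast
            field_simp
        _ ≤ M * (T / M) := mul_le_mul h1 h2.le (by positivity) hM0.le
        _ = T := by field_simp
    refine (hC.isNormalCode_prefixCode ?_).normalDensity_le hdens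
    have h4 : ((prefixCode C).card : ℝ) * binomLE (n + 1) R ≤ T * 2 ^ (n + 1) := by
      rwa [← mul_div_assoc, div_le_iff₀ (by positivity)] at hdens
    have h5 : T * (binomLE (n + 1) (R - 1) : ℝ) < binomLE (n + 1) R := by
      rw [div_lt_div_iff₀ hV1 hT0] at h3
      linarith
    have h6 : ((prefixCode C).card : ℝ) * binomLE (n + 1) (R - 1) < 2 ^ (n + 1) := by
      by_contra! hge
      have hpos : (0 : ℝ) < (prefixCode C).card := by
        have : (0 : ℝ) < (prefixCode C).card * binomLE (n + 1) (R - 1) :=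
          lt_of_lt_of_le (by positivity) hge
        exact pos_of_mul_pos_left this hW1.le
      nlinarith
    exact_mod_cast h6
  refine limsup_le_of_le (h := ?_)
  rw [eventually_atTop] at key ⊢
  obtain ⟨N, hN⟩ := key
  refine ⟨N + 1, fun n hn => ?_⟩
  obtain ⟨m, rfl⟩ : ∃ m, n = m + 1 := ⟨n - 1, by omega⟩
  exact hN m (by omega)
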